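/- Let $d \ge 1$. For a symmetric real matrix $Q \in \mathbb{R}^{d\times d}$ and $x \in \mathbb{Z}^d$ write $Q[x] := x^t Q x$. Two such matrices $Q, Q'$ are called \emph{arithmetically equivalent} if $Q' = U^t Q U$ for some $U \in \mathrm{GL}_d(\mathbb{Z}) = \{U \in \mathbb{Z}^{d\times d} : |\det U| = 1\}$. For positive definite $Q$ put $\lambda_1(Q) := \min_{x \in \mathbb{Z}^d\setminus\{0\}} Q[x]$, and let $\mathrm{Min}\, Q := \{x \in \mathbb{Z}^d : Q[x] = \lambda_1(Q)\}$ be its set of minimal vectors. Then for every positive definite symmetric matrix $Q \in \mathbb{R}^{d\times d}$ there exists a positive definite symmetric matrix $Q' \in \mathbb{R}^{d\times d}$ arithmetically equivalent to $Q$ such that $$x^t x \le \tfrac{1}{8} d^3 (d+7) \qquad \text{for all } x \in \mathrm{Min}\, Q'.$$ -/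

import Mathlib

open Matrix

/-- The value `Q[x] = xᵗ Q x` of the real quadratic form with matrix `Q` at an integral
vector `x`. -/
def quadValue {d : ℕ} (Q : Matrix (Fin d) (Fin d) ℝ) (x : Fin d → ℤ) : ℝ :=
  (fun i => (x i : ℝ)) ⬝ᵥ (Q *ᵥ fun i => (x i : ℝ))

/-- `Q` and `Q'` lie in the same orbit of the action `(Q, U) ↦ Uᵗ Q U` of `GL_d(ℤ)`. -/
def ArithEquiv {d : ℕ} (Q Q' : Matrix (Fin d) (Fin d) ℝ) : Prop :=
  ∃ U : GL (Fin d) ℤ,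
    Q' = ((U : Matrix (Fin d) (Fin d) ℤ).map (Int.cast : ℤ → ℝ))ᵀ * Q *
      (U : Matrix (Fin d) (Fin d) ℤ).map (Int.cast : ℤ → ℝ)

/-- The arithmetical minimum `λ₁(Q)`, the minimum of `Q[x]` over nonzero integral vectors `x`.
For positive definite `Q` and `d ≥ 1` the infimum is attained, see `arithMin_isLeast`. -/
noncomputable def arithMin {d : ℕ} (Q : Matrix (Fin d) (Fin d) ℝ) : ℝ :=
  sInf {r : ℝ | ∃ x : Fin d → ℤ, x ≠ 0 ∧ quadValue Q x = r}

/-- The set `Min Q` of minimal vectors of `Q`. -/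
def minVectors {d : ℕ} (Q : Matrix (Fin d) (Fin d) ℝ) : Set (Fin d → ℤ) :=
  {x | quadValue Q x = arithMin Q}

theorem quadValue_finite {d : ℕ} {Q : Matrix (Fin d) (Fin d) ℝ} (hQ : Q.PosDef) (r : ℝ) :
    {x : Fin d → ℤ | quadValue Q x ≤ r}.Finite := by
  let f : (Fin d → ℝ) → ℝ := fun y => y ⬝ᵥ (Q *ᵥ y)
  have hf : Continuous f := by fun_prop
  have hsm : ∀ (c : ℝ) (y : Fin d → ℝ), f (c • y) = c ^ 2 * f y := by
    intro c y
    simp only [f, Matrix.mulVec_smul, smul_dotProduct, dotProduct_smul, smul_eq_mul]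
    ring
  have hpos : ∀ y : Fin d → ℝ, y ≠ 0 → 0 < f y := fun y hy => by
    simpa [f] using hQ.dotProduct_mulVec_pos hy
  obtain ⟨c, hc, hcf⟩ : ∃ c : ℝ, 0 < c ∧ ∀ y : Fin d → ℝ, c * ‖y‖ ^ 2 ≤ f y := by
    rcases (Metric.sphere (0 : Fin d → ℝ) 1).eq_empty_or_nonempty with he | hne
    · refine ⟨1, one_pos, fun y => ?_⟩
      by_cases hy : y = 0
      · subst hy; simp [f]
      · exfalso
        have : (‖y‖⁻¹ • y) ∈ Metric.sphere (0 : Fin d → ℝ) 1 := by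
          simp [norm_smul, hy]
        simp [he] at this
    · obtain ⟨z, hz, hmin⟩ := (isCompact_sphere (0 : Fin d → ℝ) 1).exists_isMinOn hne
        hf.continuousOn
      have hz0 : z ≠ 0 := by
        rintro rfl
        simp at hz
      refine ⟨f z, hpos z hz0, fun y => ?_⟩
      by_cases hy : y = 0
      · subst hy; simp [f]
      · have hy' : 0 < ‖y‖ := norm_pos_iff.mpr hy
        have hm : (‖y‖⁻¹ • y) ∈ Metric.sphere (0 : Fin d → ℝ) 1 := by
          simp [norm_smul, hy]
        have h1 : f z ≤ f (‖y‖⁻¹ • y) := hmin hm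
        rw [hsm] at h1
        calc f z * ‖y‖ ^ 2 ≤ (‖y‖⁻¹ ^ 2 * f y) * ‖y‖ ^ 2 := by gcongr
          _ = f y := by field_simp
  have hsub : {x : Fin d → ℤ | quadValue Q x ≤ r} ⊆
      Set.pi Set.univ fun _ : Fin d => Set.Icc (-⌈r / c + 1⌉) ⌈r / c + 1⌉ := by
    intro x hx i _
    have hx' : f (fun i => (x i : ℝ)) ≤ r := hx
    have h1 := hcf fun i => (x i : ℝ)
    have h2 : |(x i : ℝ)| ≤ ‖fun i => (x i : ℝ)‖ := norm_le_pi_norm (fun i => (x i : ℝ)) i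
    have h3 : |(x i : ℝ)| ^ 2 ≤ r / c := by
      rw [le_div_iff₀ hc]
      have : |(x i : ℝ)| ^ 2 ≤ ‖fun i => (x i : ℝ)‖ ^ 2 := by gcongr
      nlinarith
    have h4 : |(x i : ℝ)| ≤ r / c + 1 := by nlinarith [sq_nonneg (|(x i : ℝ)| - 1)]
    have h5 : |(x i : ℝ)| ≤ (⌈r / c + 1⌉ : ℝ) := h4.trans (Int.le_ceil _)
    have h6 : |x i| ≤ ⌈r / c + 1⌉ := by exact_mod_cast h5
    exact abs_le.mp h6
  exact (Set.Finite.pi' fun _ => Set.finite_Icc _ _).subset fun x hx i => hsub hx i trivial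

/-- The minimum that defines `λ₁(Q)` exists. -/
theorem arithMin_isLeast {d : ℕ} (hd : 1 ≤ d) {Q : Matrix (Fin d) (Fin d) ℝ} (hQ : Q.PosDef) :
    IsLeast {r : ℝ | ∃ x : Fin d → ℤ, x ≠ 0 ∧ quadValue Q x = r} (arithMin Q) := by
  have hne : ∃ x₀ : Fin d → ℤ, x₀ ≠ 0 :=
    ⟨fun _ => 1, fun h => by simpa using congrFun h ⟨0, hd⟩⟩
  obtain ⟨x₀, hx₀⟩ := hne
  have hfin := (quadValue_finite hQ (quadValue Q x₀)).subset
    (Set.inter_subset_left (t := {x : Fin d → ℤ | x ≠ 0}))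
  obtain ⟨m, ⟨hm, hm0⟩, hmin⟩ := Set.exists_min_image _ (quadValue Q) hfin ⟨x₀, le_refl (quadValue Q x₀), hx₀⟩
  have hl : IsLeast {r : ℝ | ∃ x : Fin d → ℤ, x ≠ 0 ∧ quadValue Q x = r} (quadValue Q m) := by
    refine ⟨⟨m, hm0, rfl⟩, ?_⟩
    rintro _ ⟨x, hx, rfl⟩
    rcases le_total (quadValue Q x) (quadValue Q x₀) with h | h
    · exact hmin x ⟨h, hx⟩
    · exact le_trans hm h
  have : arithMin Q = quadValue Q m := hl.csInf_eq
  rw [this]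
  exact hl

/-! Minimal vectors of `Q` are controlled by short vectors of the dual form `Q⁻¹`. Suppose `W` is an
integral unimodular matrix with inverse `T`, and the rows of `W` are short for `Q⁻¹`. With Q' =
TᵗQT, a minimal x gives a minimal vector Tx of `Q`, and xᵢ = Wᵢ · Tx. By Cauchy–Schwarz for the dual
pair of forms, xᵢ² ≤ Q⁻¹[Wᵢ] λ₁(Q); summing over i bounds xᵗx.

Two facts supply the rows. The first is Banaszczyk's transference bound: the integral y with Q⁻¹[y]
≤ d²/λ₁(Q) span ℝᵈ (`span_dual_vectors_eq_top`). If some u ≠ 0 were orthogonal to all of them, a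
suitable multiple of u would be far from ℤᵈ, making the Gaussian sum over the translate by it small.
Poisson summation writes the same sum with cosines that equal 1 except at long dual vectors, making
it large (`not_forall_le_of_orthogonal`).

The second fact turns d independent lattice vectors of squared length at most R into a lattice basis
whose i-th member, counted from 1, has squared length at most max(1, i/4) R
(`exists_short_int_basis`). With R = d²/λ₁(Q) this gives xᵢ² ≤ max(1, i/4) d², and the sum over i is
at most d³(d+7)/8. -/

/-- The value of the real quadratic form with matrix `A` at a real vector. -/
def realQuad {d : ℕ} (A : Matrix (Fin d) (Fin d) ℝ) (u : Fin d → ℝ) : ℝ :=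
  u ⬝ᵥ (A *ᵥ u)

/-- The real vector with the same coordinates as a given integral vector. -/
def intVec {d : ℕ} (x : Fin d → ℤ) : Fin d → ℝ := fun i => (x i : ℝ)

/-! ### Positive definite forms and convergence of their Gaussian series -/

section realQuad

variable {d : ℕ} {A : Matrix (Fin d) (Fin d) ℝ}

theorem quadValue_eq_realQuad (x : Fin d → ℤ) : quadValue A x = realQuad A (intVec x) := rfl

theorem continuous_realQuad : Continuous (realQuad A) := by
  unfold realQuad; fun_prop

theorem realQuad_smul (c : ℝ) (u : Fin d → ℝ) : realQuad A (c • u) = c ^ 2 * realQuad A u := by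
  simp only [realQuad, Matrix.mulVec_smul, smul_dotProduct, dotProduct_smul, smul_eq_mul]
  ring

theorem realQuad_smul_matrix (c : ℝ) (u : Fin d → ℝ) : realQuad (c • A) u = c * realQuad A u := by
  simp [realQuad, Matrix.smul_mulVec]

theorem realQuad_parallelogram (u v : Fin d → ℝ) :
    realQuad A (u + v) + realQuad A (u - v) = 2 * realQuad A u + 2 * realQuad A v := by
  simp only [realQuad, Matrix.mulVec_add, Matrix.mulVec_sub, add_dotProduct, sub_dotProduct,
    dotProduct_add, dotProduct_sub]
  ring

theorem realQuad_nonneg (hA : A.PosDef) (u : Fin d → ℝ) : 0 ≤ realQuad A u := by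
  simpa [realQuad] using hA.posSemidef.dotProduct_mulVec_nonneg u

theorem realQuad_pos (hA : A.PosDef) {u : Fin d → ℝ} (hu : u ≠ 0) : 0 < realQuad A u := by
  simpa [realQuad] using hA.dotProduct_mulVec_pos hu

/-- The parallelogram law with one term dropped: a squared triangle inequality, bounding the form on
a translate from below. -/
theorem realQuad_le_two_mul (hA : A.PosDef) (u v : Fin d → ℝ) :
    realQuad A v ≤ 2 * realQuad A (v + u) + 2 * realQuad A u := by
  have h := realQuad_parallelogram (A := A) (v + u) u
  have h2 := realQuad_nonneg hA (v + u + u)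
  rw [add_sub_cancel_right] at h
  linarith

theorem Matrix.PosDef.exists_isUnit_eq_transpose_mul (hA : A.PosDef) :
    ∃ S : Matrix (Fin d) (Fin d) ℝ, IsUnit S ∧ A = Sᵀ * S := by
  open scoped MatrixOrder in
  obtain ⟨S, hS, h⟩ := CStarAlgebra.isStrictlyPositive_iff_eq_star_mul_self.mp hA.isStrictlyPositive
  exact ⟨S, hS, by simpa [star_eq_conjTranspose] using h⟩

theorem realQuad_transpose_mul (S : Matrix (Fin d) (Fin d) ℝ) (u : Fin d → ℝ) :
    realQuad (Sᵀ * S) u = ∑ i, (S *ᵥ u) i ^ 2 := by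
  simp only [realQuad, ← Matrix.mulVec_mulVec, Matrix.dotProduct_mulVec u Sᵀ, Matrix.vecMul_transpose]
  simp [dotProduct, sq]

theorem exists_mul_sum_sq_le_realQuad (hA : A.PosDef) :
    ∃ c : ℝ, 0 < c ∧ ∀ u : Fin d → ℝ, c * ∑ i, u i ^ 2 ≤ realQuad A u := by
  obtain ⟨S, hS, rfl⟩ := hA.exists_isUnit_eq_transpose_mul
  refine ⟨(1 + ∑ i, ∑ j, (S⁻¹ i j) ^ 2)⁻¹, by positivity, fun u => ?_⟩
  rw [realQuad_transpose_mul, inv_mul_le_iff₀ (by positivity)]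
  have h : u = S⁻¹ *ᵥ (S *ᵥ u) := by
    rw [Matrix.mulVec_mulVec, Matrix.nonsing_inv_mul _ ((Matrix.isUnit_iff_isUnit_det S).mp hS),
      Matrix.one_mulVec]
  calc ∑ i, u i ^ 2 = ∑ i, (S⁻¹ *ᵥ (S *ᵥ u)) i ^ 2 := by rw [← h]
    _ ≤ ∑ i, (∑ j, (S⁻¹ i j) ^ 2) * ∑ j, (S *ᵥ u) j ^ 2 := by
        refine Finset.sum_le_sum fun i _ => ?_
        exact Finset.sum_mul_sq_le_sq_mul_sq Finset.univ (fun j => S⁻¹ i j) (S *ᵥ u)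
    _ = (∑ i, ∑ j, (S⁻¹ i j) ^ 2) * ∑ j, (S *ᵥ u) j ^ 2 := by rw [Finset.sum_mul]
    _ ≤ _ := by
        gcongr
        linarith

theorem summable_prod_int_of_nonneg {f : ℤ → ℝ} (hf : ∀ n, 0 ≤ f n) (hs : Summable f) :
    Summable fun x : Fin d → ℤ => ∏ i, f (x i) := by
  classical
  refine summable_of_sum_le (c := (∑' n, f n) ^ d) (fun x => Finset.prod_nonneg fun i _ => hf _)
    fun s => ?_
  calc ∑ x ∈ s, ∏ i, f (x i)
      ≤ ∑ x ∈ Fintype.piFinset fun i : Fin d => s.image fun x => x i, ∏ i, f (x i) := by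
        refine Finset.sum_le_sum_of_subset_of_nonneg (fun x hx => ?_)
          fun x _ _ => Finset.prod_nonneg fun i _ => hf _
        simp only [Fintype.mem_piFinset]
        exact fun i => Finset.mem_image_of_mem _ hx
    _ = ∏ i : Fin d, ∑ n ∈ s.image fun x => x i, f n := (Finset.prod_univ_sum _ _).symm
    _ ≤ ∏ _i : Fin d, ∑' n, f n := by
        refine Finset.prod_le_prod (fun i _ => Finset.sum_nonneg fun n _ => hf n) fun i _ => ?_
        exact hs.sum_le_tsum _ fun n _ => hf n
    _ = _ := by simp

theorem summable_exp_neg_mul_int_sq {c : ℝ} (hc : 0 < c) :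
    Summable fun n : ℤ => Real.exp (-c * (n : ℝ) ^ 2) := by
  have h0 : Summable fun n : ℕ => Real.exp (-c * (n : ℝ)) := by
    simpa [mul_comm] using Real.summable_exp_nat_mul_iff.mpr (neg_lt_zero.mpr hc)
  have h : Summable fun n : ℕ => Real.exp (-c * (n : ℝ) ^ 2) := by
    refine h0.of_nonneg_of_le (fun n => (Real.exp_pos _).le) fun n => ?_
    refine Real.exp_le_exp.mpr ?_
    have : (n : ℝ) ≤ (n : ℝ) ^ 2 := by exact_mod_cast Nat.le_self_pow two_ne_zero n
    nlinarith
  exact Summable.of_nat_of_neg (by simpa using h) (by simpa using h)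

theorem summable_exp_neg_realQuad (hA : A.PosDef) {b : ℝ} (hb : 0 < b) (u : Fin d → ℝ) :
    Summable fun x : Fin d → ℤ => Real.exp (-b * realQuad A (intVec x + u)) := by
  obtain ⟨c, hc, h⟩ := exists_mul_sum_sq_le_realQuad hA
  have h1 : Summable fun x : Fin d → ℤ =>
      Real.exp (b * realQuad A u) * ∏ i, Real.exp (-(b * c / 2) * (x i : ℝ) ^ 2) :=
    (summable_prod_int_of_nonneg (fun n => (Real.exp_pos _).le)
      (summable_exp_neg_mul_int_sq (by positivity))).mul_left _
  refine h1.of_nonneg_of_le (fun x => (Real.exp_pos _).le) fun x => ?_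
  rw [← Real.exp_sum, ← Real.exp_add, Real.exp_le_exp, ← Finset.mul_sum]
  have h2 := realQuad_le_two_mul hA u (intVec x)
  have h3 := h (intVec x)
  simp only [intVec] at h2 h3 ⊢
  nlinarith

end realQuad

/-! ### Poisson summation on ℤᵈ -/

section Poisson

variable {d : ℕ}

open MeasureTheory

theorem hasSum_integral_unitCube_translate {E : Type*} [NormedAddCommGroup E] [NormedSpace ℝ E]
    {g : (Fin d → ℝ) → E} (hg : Integrable g) :
    HasSum (fun n : Fin d → ℤ =>
      ∫ x in {x : Fin d → ℝ | ∀ i, x i ∈ Set.Ioc (0 : ℝ) (0 + 1)}, g (x + intVec n)) (∫ x, g x) := by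
  let s : (Fin d → ℤ) → Set (Fin d → ℝ) := fun n => {x | ∀ i, x i - n i ∈ Set.Ioc (0 : ℝ) (0 + 1)}
  have hm : ∀ n, MeasurableSet (s n) := fun n => by
    have : s n = ⋂ i, {x : Fin d → ℝ | x i - n i ∈ Set.Ioc (0 : ℝ) (0 + 1)} := by
      ext x; simp [s]
    rw [this]
    exact MeasurableSet.iInter fun i =>
      measurableSet_Ioc.preimage ((measurable_pi_apply i).sub_const _)
  have hd : Pairwise (Function.onFun Disjoint s) := by
    intro m n hmn
    refine Set.disjoint_left.mpr fun x hx hx' => hmn (funext fun i => ?_)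
    refine (existsUnique_sub_zsmul_mem_Ioc (one_pos : (0 : ℝ) < 1) (x i) 0).unique ?_ ?_
    · simpa using hx i
    · simpa using hx' i
  have hu : ⋃ n, s n = Set.univ := by
    refine Set.eq_univ_of_forall fun x => ?_
    choose n hn using fun i =>
      (existsUnique_sub_zsmul_mem_Ioc (one_pos : (0 : ℝ) < 1) (x i) 0).exists
    exact Set.mem_iUnion.mpr ⟨n, fun i => by simpa using hn i⟩
  have h := hasSum_integral_iUnion hm hd (f := g) (μ := volume) hg.integrableOn
  rw [hu, setIntegral_univ] at h
  refine h.congr_fun fun n => ?_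
  have h2 := (measurePreserving_add_right (volume : Measure (Fin d → ℝ))
    (intVec n)).setIntegral_preimage_emb (MeasurableEquiv.addRight _).measurableEmbedding g (s n)
  rw [← h2]
  congr 2
  ext x
  simp [s, intVec]

theorem integral_unitCube_tsum {g : (Fin d → ℝ) → ℂ} (hg : Integrable g) :
    ∫ x in {x : Fin d → ℝ | ∀ i, x i ∈ Set.Ioc (0 : ℝ) (0 + 1)}, ∑' n : Fin d → ℤ, g (x + intVec n)
      = ∫ x, g x := by
  refine (hasSum_integral_of_summable_integral_norm (fun n => ?_) ?_).unique
    (hasSum_integral_unitCube_translate hg)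
  · exact (hg.comp_add_right (intVec n)).integrableOn
  · exact (hasSum_integral_unitCube_translate hg.norm).summable

theorem mFourier_coe (k : Fin d → ℤ) (x : Fin d → ℝ) :
    UnitAddTorus.mFourier k (fun i => (x i : UnitAddCircle)) =
      Complex.exp (2 * Real.pi * Complex.I * (intVec k ⬝ᵥ x : ℝ)) := by
  simp only [UnitAddTorus.mFourier, ContinuousMap.coe_mk, fourier_coe_apply, ← Complex.exp_sum]
  congr 1
  simp only [dotProduct, intVec, Complex.ofReal_sum, Finset.mul_sum]
  refine Finset.sum_congr rfl fun i _ => ?_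
  push_cast
  ring

/-- Characters are invariant under integral translation, so the integral over the torus unfolds to
one over ℝᵈ. -/
theorem mFourierCoeff_periodization {g : (Fin d → ℝ) → ℂ} (hg : Integrable g)
    (F : UnitAddTorus (Fin d) → ℂ)
    (hF : ∀ x : Fin d → ℝ, HasSum (fun n : Fin d → ℤ => g (x + intVec n)) (F fun i => x i))
    (k : Fin d → ℤ) :
    UnitAddTorus.mFourierCoeff F k =
      ∫ x, Complex.exp (2 * Real.pi * Complex.I * (intVec (-k) ⬝ᵥ x : ℝ)) * g x := by
  rw [UnitAddTorus.mFourierCoeff_eq_integral F k 0]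
  have hg' : Integrable fun x : Fin d → ℝ =>
      Complex.exp (2 * Real.pi * Complex.I * (intVec (-k) ⬝ᵥ x : ℝ)) * g x := by
    refine hg.bdd_mul (c := 1) (Continuous.aestronglyMeasurable ?_) (Filter.Eventually.of_forall fun x => ?_)
    · simp only [dotProduct]
      fun_prop
    · rw [← mFourier_coe]
      exact ((UnitAddTorus.mFourier (-k)).norm_coe_le_norm _).trans_eq UnitAddTorus.mFourier_norm
  rw [← integral_unitCube_tsum hg']
  refine integral_congr_ae (Filter.Eventually.of_forall fun x => ?_)
  simp only [smul_eq_mul]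
  rw [← (hF x).tsum_eq, ← tsum_mul_left]
  refine tsum_congr fun n => ?_
  congr 1
  rw [← mFourier_coe]
  congr 1
  funext i
  simp [intVec]

theorem hasSum_poisson {g : (Fin d → ℝ) → ℂ} (hg : Integrable g) {F : (Fin d → ℝ) → ℂ}
    (hFc : Continuous F) (hF : ∀ x, HasSum (fun n : Fin d → ℤ => g (x + intVec n)) (F x))
    (hs : Summable fun k : Fin d → ℤ =>
      ∫ x, Complex.exp (2 * Real.pi * Complex.I * (intVec (-k) ⬝ᵥ x : ℝ)) * g x)
    (u : Fin d → ℝ) :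
    HasSum (fun k : Fin d → ℤ =>
      (∫ x, Complex.exp (2 * Real.pi * Complex.I * (intVec (-k) ⬝ᵥ x : ℝ)) * g x) *
        Complex.exp (2 * Real.pi * Complex.I * (intVec k ⬝ᵥ u : ℝ))) (F u) := by
  have hper : ∀ x (m : Fin d → ℤ), F (x + intVec m) = F x := by
    intro x m
    have h := (Equiv.addRight m).hasSum_iff.mpr (hF x)
    refine (hF (x + intVec m)).unique (h.congr_fun fun n => ?_)
    simp only [Function.comp, Equiv.coe_addRight]
    congr 1
    funext i
    simp [intVec]
    ring
  -- `F` descends to the torus through representatives in [0, 1); continuity of `G` follows from the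
  -- open quotient map, not from this formula.
  let G : UnitAddTorus (Fin d) → ℂ := fun t => F fun i => (AddCircle.equivIco 1 0 (t i) : ℝ)
  have hG : ∀ x : Fin d → ℝ, G (fun i => (x i : UnitAddCircle)) = F x := by
    intro x
    have hx : x = (fun i => Int.fract (x i)) + intVec fun i => ⌊x i⌋ := by
      funext i
      simp [intVec, Int.fract_add_floor]
    conv_rhs => rw [hx, hper]
    simp [G, AddCircle.coe_equivIco_mk_apply]
  have hq : IsOpenQuotientMap
      (Pi.map fun (_ : Fin d) (x : ℝ) => (x : UnitAddCircle)) :=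
    IsOpenQuotientMap.piMap fun _ => QuotientAddGroup.isOpenQuotientMap_mk
  have hGc : Continuous G := by
    rw [← hq.continuous_comp_iff]
    exact hFc.congr fun x => (hG x).symm
  have hco : ∀ k, UnitAddTorus.mFourierCoeff (⟨G, hGc⟩ : C(UnitAddTorus (Fin d), ℂ)) k = _ :=
    mFourierCoeff_periodization hg G fun x => by rw [hG]; exact hF x
  have h := UnitAddTorus.hasSum_mFourier_series_apply_of_summable
    (f := ⟨G, hGc⟩) (hs.congr fun k => (hco k).symm) (fun i => (u i : UnitAddCircle))
  simp only [hco, mFourier_coe, smul_eq_mul] at h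
  simpa only [ContinuousMap.coe_mk, hG] using h

end Poisson

/-! ### Theta inversion for a positive definite form -/

section Theta

variable {d : ℕ} {A : Matrix (Fin d) (Fin d) ℝ}

open MeasureTheory

theorem integral_comp_mulVec {E : Type*} [NormedAddCommGroup E] [NormedSpace ℝ E]
    {S : Matrix (Fin d) (Fin d) ℝ} (hS : S.det ≠ 0) (h : (Fin d → ℝ) → E) (hc : Continuous h) :
    ∫ x, h (S *ᵥ x) = |S.det|⁻¹ • ∫ x, h x := by
  have h1 := integral_map (μ := (volume : Measure (Fin d → ℝ))) (φ := Matrix.toLin' S)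
    (LinearMap.continuous_of_finiteDimensional _).measurable.aemeasurable
    (f := h) hc.aestronglyMeasurable
  rw [Real.map_matrix_volume_pi_eq_smul_volume_pi hS, integral_smul_measure] at h1
  simp only [Matrix.toLin'_apply] at h1
  rw [← h1, ENNReal.toReal_ofReal (abs_nonneg _), abs_inv]

theorem integrable_comp_mulVec {E : Type*} [NormedAddCommGroup E]
    {S : Matrix (Fin d) (Fin d) ℝ} (hS : S.det ≠ 0) {h : (Fin d → ℝ) → E} (hh : Integrable h) :
    Integrable fun x => h (S *ᵥ x) := by
  have hm : Measurable (Matrix.toLin' S) :=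
    (LinearMap.continuous_of_finiteDimensional _).measurable
  have h1 : Integrable h (Measure.map (Matrix.toLin' S) volume) := by
    rw [Real.map_matrix_volume_pi_eq_smul_volume_pi hS]
    exact hh.smul_measure ENNReal.ofReal_ne_top
  exact h1.comp_measurable hm

/-- Writing A = SᵗS and substituting v = Sx reduces this to the standard Gaussian. The frequency
becomes c = S⁻ᵗw, with |c|² = A⁻¹[w]. -/
theorem integral_gaussian_realQuad (hA : A.PosDef) (w : Fin d → ℝ) :
    (Integrable fun x : Fin d → ℝ => Complex.exp (2 * Real.pi * Complex.I * (w ⬝ᵥ x : ℝ)) *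
      (Real.exp (-Real.pi * realQuad A x) : ℂ)) ∧
    ∫ x : Fin d → ℝ, Complex.exp (2 * Real.pi * Complex.I * (w ⬝ᵥ x : ℝ)) *
      (Real.exp (-Real.pi * realQuad A x) : ℂ) =
      ((√A.det)⁻¹ * Real.exp (-Real.pi * realQuad A⁻¹ w) : ℝ) := by
  obtain ⟨S, hS, rfl⟩ := hA.exists_isUnit_eq_transpose_mul
  have hSd : IsUnit S.det := (Matrix.isUnit_iff_isUnit_det S).mp hS
  set c : Fin d → ℝ := (S⁻¹)ᵀ *ᵥ w with hc
  have hwc : ∀ x, w ⬝ᵥ x = c ⬝ᵥ (S *ᵥ x) := by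
    intro x
    rw [hc, Matrix.mulVec_transpose, ← Matrix.dotProduct_mulVec, Matrix.mulVec_mulVec,
      Matrix.nonsing_inv_mul _ hSd, Matrix.one_mulVec]
  have hq : realQuad (Sᵀ * S)⁻¹ w = ∑ i, c i ^ 2 := by
    rw [hc, ← realQuad_transpose_mul, Matrix.mul_inv_rev, Matrix.transpose_transpose,
      Matrix.transpose_nonsing_inv]
  let h : (Fin d → ℝ) → ℂ := fun v => Complex.exp (-(Real.pi : ℂ) * ∑ i, (v i : ℂ) ^ 2 +
      ∑ i, (2 * Real.pi * Complex.I * c i) * (v i : ℂ))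
  have hpi : 0 < ((Real.pi : ℂ)).re := by simpa using Real.pi_pos
  have hh : (fun x : Fin d → ℝ => Complex.exp (2 * Real.pi * Complex.I * (w ⬝ᵥ x : ℝ)) *
      (Real.exp (-Real.pi * realQuad (Sᵀ * S) x) : ℂ)) = fun x => h (S *ᵥ x) := by
    funext x
    rw [realQuad_transpose_mul, hwc]
    simp only [h, Complex.ofReal_exp, ← Complex.exp_add, dotProduct]
    congr 1
    push_cast
    rw [add_comm, Finset.mul_sum (a := 2 * Real.pi * Complex.I)]
    congr 1
    exact Finset.sum_congr rfl fun i _ => by ring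
  have hint : Integrable h := GaussianFourier.integrable_cexp_neg_mul_sum_add hpi _
  have hcont : Continuous h := by fun_prop
  rw [hh, integral_comp_mulVec hSd.ne_zero h hcont]
  refine ⟨integrable_comp_mulVec hSd.ne_zero hint, ?_⟩
  simp only [h]
  rw [GaussianFourier.integral_cexp_neg_mul_sum_add hpi, hq, Matrix.det_mul, Matrix.det_transpose,
    ← sq, Real.sqrt_sq_eq_abs, div_self (by exact_mod_cast Real.pi_ne_zero), Complex.one_cpow,
    one_mul, Complex.real_smul]
  push_cast
  congr 2
  have hp : (Real.pi : ℂ) ≠ 0 := by exact_mod_cast Real.pi_ne_zero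
  simp only [mul_pow, Complex.I_sq, ← Finset.mul_sum]
  field_simp
  ring

/-- The Gaussian sum of the form `A` over the translate `ℤᵈ + u`. -/
noncomputable def gaussianSum (A : Matrix (Fin d) (Fin d) ℝ) (u : Fin d → ℝ) : ℝ :=
  ∑' x : Fin d → ℤ, Real.exp (-Real.pi * realQuad A (intVec x + u))

theorem continuous_gaussianSum (hA : A.PosDef) : Continuous (gaussianSum A) := by
  refine continuous_iff_continuousAt.mpr fun u₀ => ?_
  have hs : IsOpen {u | realQuad A u < realQuad A u₀ + 1} :=
    isOpen_lt continuous_realQuad continuous_const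
  refine ContinuousOn.continuousAt ?_ (hs.mem_nhds (x := u₀) (by simp))
  -- Majorant for the M-test near `u₀`: A[x + u] ≥ A[x]/2 − A[u], with A[u] bounded on the
  -- neighbourhood.
  have hsum : Summable fun x : Fin d → ℤ => Real.exp (Real.pi * (realQuad A u₀ + 1)) *
      Real.exp (-(Real.pi / 2) * realQuad A (intVec x + 0)) :=
    (summable_exp_neg_realQuad hA (by positivity) 0).mul_left _
  refine continuousOn_tsum (fun x => Continuous.continuousOn ?_) hsum fun x u hu => ?_
  · exact Real.continuous_exp.comp (continuous_const.mul
      (continuous_realQuad.comp (continuous_const.add continuous_id)))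
  · rw [Real.norm_eq_abs, Real.abs_exp, ← Real.exp_add, Real.exp_le_exp, add_zero]
    have h2 := realQuad_le_two_mul hA u (intVec x)
    have hu' : realQuad A u < realQuad A u₀ + 1 := hu
    nlinarith [Real.pi_pos]

theorem hasSum_gaussianSum (hA : A.PosDef) (u : Fin d → ℝ) :
    HasSum (fun k : Fin d → ℤ => (√A.det)⁻¹ * Real.exp (-Real.pi * realQuad A⁻¹ (intVec k)) *
      Real.cos (2 * Real.pi * (intVec k ⬝ᵥ u))) (gaussianSum A u) := by
  have hneg : ∀ k : Fin d → ℤ, realQuad A⁻¹ (intVec (-k)) = realQuad A⁻¹ (intVec k) := by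
    intro k
    have : intVec (-k) = (-1 : ℝ) • intVec k := by funext i; simp [intVec]
    rw [this, realQuad_smul]
    ring
  have hi := integral_gaussian_realQuad hA
  have hg : Integrable fun x : Fin d → ℝ => (Real.exp (-Real.pi * realQuad A x) : ℂ) := by
    simpa using (hi 0).1
  have hF : ∀ x, HasSum (fun n : Fin d → ℤ =>
      (Real.exp (-Real.pi * realQuad A (x + intVec n)) : ℂ)) (gaussianSum A x : ℂ) := by
    intro x
    have := (summable_exp_neg_realQuad hA Real.pi_pos x).hasSum
    simp only [add_comm _ x] at this
    simp only [gaussianSum, add_comm _ x]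
    exact_mod_cast this
  have hsum : Summable fun k : Fin d → ℤ =>
      (√A.det)⁻¹ * Real.exp (-Real.pi * realQuad A⁻¹ (intVec k)) := by
    simpa using (summable_exp_neg_realQuad hA.inv Real.pi_pos 0).mul_left _
  have h := hasSum_poisson hg
    (Complex.continuous_ofReal.comp (continuous_gaussianSum hA)) hF ?_ u
  · have h2 := Complex.hasSum_re h
    simp only [(hi _).2, hneg] at h2
    simp only [Function.comp, Complex.ofReal_re, Complex.re_ofReal_mul] at h2
    refine h2.congr_fun fun k => ?_
    congr 1
    rw [show (2 * Real.pi * Complex.I * (intVec k ⬝ᵥ u : ℝ) : ℂ) =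
      (2 * Real.pi * (intVec k ⬝ᵥ u) : ℝ) * Complex.I by push_cast; ring, Complex.exp_ofReal_mul_I_re]
  · simp only [(hi _).2, hneg]
    exact_mod_cast hsum

end Theta

/-! ### Banaszczyk's transference bound -/

section Transference

variable {d : ℕ} {A : Matrix (Fin d) (Fin d) ℝ}

theorem summable_gaussianSum (hA : A.PosDef) (u : Fin d → ℝ) :
    Summable fun x : Fin d → ℤ => Real.exp (-Real.pi * realQuad A (intVec x + u)) :=
  summable_exp_neg_realQuad hA Real.pi_pos u

theorem gaussianSum_pos (hA : A.PosDef) (u : Fin d → ℝ) : 0 < gaussianSum A u :=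
  (summable_gaussianSum hA u).tsum_pos (fun _ => (Real.exp_pos _).le) 0 (Real.exp_pos _)

theorem gaussianSum_zero (hA : A.PosDef) : gaussianSum A 0 = (√A.det)⁻¹ * gaussianSum A⁻¹ 0 := by
  have h := (hasSum_gaussianSum hA 0).tsum_eq
  simp only [dotProduct_zero, mul_zero, Real.cos_zero, mul_one, tsum_mul_left] at h
  rw [← h]
  simp only [gaussianSum, add_zero]

theorem gaussianSum_le_gaussianSum_zero (hA : A.PosDef) (u : Fin d → ℝ) :
    gaussianSum A u ≤ gaussianSum A 0 := by
  refine hasSum_le (fun k => ?_) (hasSum_gaussianSum hA u) (hasSum_gaussianSum hA 0)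
  refine mul_le_mul_of_nonneg_left ?_ (by positivity)
  simpa using Real.cos_le_one _

/-- On the dual side, shrinking A by t ≤ 1 enlarges the form and so decreases the sum; only the
determinant factor is lost. -/
theorem gaussianSum_smul_zero_le (hA : A.PosDef) {t : ℝ} (ht : 0 < t) (ht1 : t ≤ 1) :
    gaussianSum (t • A) 0 ≤ (√t ^ d)⁻¹ * gaussianSum A 0 := by
  have hinv : (t • A)⁻¹ = t⁻¹ • A⁻¹ := by
    have := Matrix.inv_smul' A (Units.mk0 t ht.ne') hA.det_pos.ne'.isUnit
    simpa [Units.smul_def] using this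
  rw [gaussianSum_zero (hA.smul ht), gaussianSum_zero hA, hinv, Matrix.det_smul, Fintype.card_fin,
    Real.sqrt_mul (by positivity), mul_inv, mul_assoc]
  have hsq : √(t ^ d) = √t ^ d := by
    rw [Real.sqrt_eq_iff_mul_self_eq (by positivity) (by positivity), ← mul_pow,
      Real.mul_self_sqrt ht.le]
  rw [hsq]
  refine mul_le_mul_of_nonneg_left (mul_le_mul_of_nonneg_left ?_ (by positivity)) (by positivity)
  have hinvpos : 0 < t⁻¹ := by positivity
  refine (summable_gaussianSum (hA.inv.smul hinvpos) 0).tsum_le_tsum (fun x => ?_)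
    (summable_gaussianSum hA.inv 0)
  rw [realQuad_smul_matrix, Real.exp_le_exp]
  have h1 : 1 ≤ t⁻¹ := (one_le_inv₀ ht).mpr ht1
  have h2 := realQuad_nonneg hA.inv (intVec x + 0)
  nlinarith [Real.pi_pos, mul_nonneg Real.pi_pos.le (mul_nonneg (sub_nonneg.mpr h1) h2)]

open Classical in
-- Where A ≥ r, split off the factor e^(−π(1−t)A) ≤ e^(−π(1−t)r). What remains is a term of the
-- Gaussian sum of tA.
theorem gaussianSum_tail_le (hA : A.PosDef) (u : Fin d → ℝ) {t : ℝ} (ht : 0 < t) (ht1 : t ≤ 1)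
    (r : ℝ) :
    ∑' x : Fin d → ℤ, (if r ≤ realQuad A (intVec x + u) then
      Real.exp (-Real.pi * realQuad A (intVec x + u)) else 0) ≤
      Real.exp (-Real.pi * (1 - t) * r) * (√t ^ d)⁻¹ * gaussianSum A 0 := by
  have h1 : ∑' x : Fin d → ℤ, (if r ≤ realQuad A (intVec x + u) then
      Real.exp (-Real.pi * realQuad A (intVec x + u)) else 0) ≤
      Real.exp (-Real.pi * (1 - t) * r) * gaussianSum (t • A) u := by
    rw [gaussianSum, ← tsum_mul_left]
    have hs := (summable_gaussianSum (hA.smul ht) u).mul_left (Real.exp (-Real.pi * (1 - t) * r))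
    have hle : ∀ x : Fin d → ℤ, (if r ≤ realQuad A (intVec x + u) then
      Real.exp (-Real.pi * realQuad A (intVec x + u)) else 0) ≤
        Real.exp (-Real.pi * (1 - t) * r) *
          Real.exp (-Real.pi * realQuad (t • A) (intVec x + u)) := by
      intro x
      split_ifs with h
      · rw [← Real.exp_add, Real.exp_le_exp, realQuad_smul_matrix]
        nlinarith [mul_nonneg (mul_nonneg Real.pi_pos.le (sub_nonneg.mpr ht1)) (sub_nonneg.mpr h)]
      · positivity
    refine Summable.tsum_le_tsum hle (hs.of_nonneg_of_le (fun x => ?_) hle) hs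
    split_ifs <;> positivity
  refine h1.trans ?_
  rw [mul_assoc (Real.exp _)]
  refine mul_le_mul_of_nonneg_left ?_ (by positivity)
  exact (gaussianSum_le_gaussianSum_zero (hA.smul ht) u).trans (gaussianSum_smul_zero_le hA ht ht1)

theorem gaussianSum_le_of_forall_le (hA : A.PosDef) (u : Fin d → ℝ) {t : ℝ} (ht : 0 < t)
    (ht1 : t ≤ 1) {r : ℝ} (h : ∀ x : Fin d → ℤ, r ≤ realQuad A (intVec x + u)) :
    gaussianSum A u ≤ Real.exp (-Real.pi * (1 - t) * r) * (√t ^ d)⁻¹ * gaussianSum A 0 := by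
  classical
  have := gaussianSum_tail_le hA u ht ht1 r
  simpa [h, gaussianSum] using this

/-- In the Poisson expansion the cosine is 1 if k · u = 0 and at least −1 otherwise, so the loss
against u = 0 is at most twice the dual tail. -/
theorem le_gaussianSum_of_orthogonal (hA : A.PosDef) (u : Fin d → ℝ) {t : ℝ} (ht : 0 < t)
    (ht1 : t ≤ 1) {r : ℝ}
    (h : ∀ k : Fin d → ℤ, intVec k ⬝ᵥ u ≠ 0 → r ≤ realQuad A⁻¹ (intVec k)) :
    (1 - 2 * (Real.exp (-Real.pi * (1 - t) * r) * (√t ^ d)⁻¹)) * gaussianSum A 0 ≤ gaussianSum A u := by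
  classical
  have htail := gaussianSum_tail_le hA.inv 0 ht ht1 r
  simp only [add_zero] at htail
  have hs : Summable fun x : Fin d → ℤ => (if r ≤ realQuad A⁻¹ (intVec x) then
      Real.exp (-Real.pi * realQuad A⁻¹ (intVec x)) else 0) := by
    have h0 := summable_gaussianSum hA.inv 0
    simp only [add_zero] at h0
    refine h0.of_nonneg_of_le (fun x => ?_) fun x => ?_
    · split_ifs <;> positivity
    · split_ifs
      · rfl
      · positivity
  have h0 := (hasSum_gaussianSum hA 0).sub (hs.hasSum.mul_left (2 * (√A.det)⁻¹))
  have hle := hasSum_le (fun k => ?_) h0 (hasSum_gaussianSum hA u)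
  · have hz := gaussianSum_zero hA
    have hC : 0 ≤ (√A.det)⁻¹ := by positivity
    have := mul_le_mul_of_nonneg_left htail hC
    rw [mul_left_comm, ← hz] at this
    linarith
  · simp only [dotProduct_zero, mul_zero, Real.cos_zero, mul_one]
    have hC : 0 ≤ (√A.det)⁻¹ := by positivity
    have he := (Real.exp_pos (-Real.pi * realQuad A⁻¹ (intVec k))).le
    split_ifs with hk
    · have := mul_nonneg (mul_nonneg hC he)
        (by linarith [Real.neg_one_le_cos (2 * Real.pi * (intVec k ⬝ᵥ u))] :
          0 ≤ 1 + Real.cos (2 * Real.pi * (intVec k ⬝ᵥ u)))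
      linarith
    · have h1 : intVec k ⬝ᵥ u = 0 := by
        by_contra hne
        exact hk (h k hne)
      simp [h1]

theorem exp_mul_inv_sqrt_pow_le {d : ℕ} (hd : 2 ≤ d) {s t c : ℝ} (ht : 0 < t)
    (hc : Real.exp (2 * s) ≤ c * t) (hc1 : c ≤ 1) :
    Real.exp (s * d) * (√t ^ d)⁻¹ ≤ c := by
  have h1 : Real.exp (s * d) * (√t ^ d)⁻¹ = (Real.exp s / √t) ^ d := by
    rw [div_pow, ← Real.exp_nat_mul, div_eq_mul_inv, mul_comm s]
  have h2 : (Real.exp s / √t) ^ 2 ≤ c := by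
    rw [div_pow, Real.sq_sqrt ht.le, div_le_iff₀ ht, ← Real.exp_nat_mul]
    exact_mod_cast hc
  have h3 : Real.exp s / √t ≤ 1 := by
    by_contra! h
    nlinarith
  rw [h1]
  exact (pow_le_pow_of_le_one (by positivity) h3 hd).trans h2

theorem not_forall_le_of_orthogonal (hd : 2 ≤ d) (hA : A.PosDef) (u : Fin d → ℝ)
    (h1 : ∀ x : Fin d → ℤ, 2 / 5 * d ≤ realQuad A (intVec x + u))
    (h2 : ∀ k : Fin d → ℤ, intVec k ⬝ᵥ u ≠ 0 → 5 / 8 * d ≤ realQuad A⁻¹ (intVec k)) : False := by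
  -- Each t is close to d/(2πr), which minimises the tail factor. The sum at `u` over the sum at 0
  -- will be at most 14/25 = 0.56, yet at least 1 − 2 · 17/80 = 0.575.
  have hu := gaussianSum_le_of_forall_le hA u (t := 2 / 5) (by norm_num) (by norm_num) h1
  have hl := le_gaussianSum_of_orthogonal hA u (t := 1 / 4) (by norm_num) (by norm_num) h2
  have hp := gaussianSum_pos hA 0
  have hpi := Real.pi_gt_d2
  have he := Real.exp_one_gt_d9
  have e1 : Real.exp (2 * (-Real.pi * (1 - 2 / 5) * (2 / 5))) ≤ 14 / 25 * (2 / 5) := by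
    have h : Real.exp (2 * (-Real.pi * (1 - 2 / 5) * (2 / 5))) ≤ Real.exp (-(3 / 2)) := by
      rw [Real.exp_le_exp]; linarith
    refine h.trans ?_
    have h3 : Real.exp (-(3 / 2)) ^ 2 * Real.exp 1 ^ 3 = 1 := by
      rw [← Real.exp_nat_mul, ← Real.exp_nat_mul, ← Real.exp_add]
      norm_num
    have h4 : (2.7182818283 : ℝ) ^ 3 ≤ Real.exp 1 ^ 3 := by gcongr
    by_contra! h5
    have h6 : (14 / 25 * (2 / 5) : ℝ) ^ 2 ≤ Real.exp (-(3 / 2)) ^ 2 := by gcongr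
    have h7 := mul_le_mul h6 h4 (by norm_num) (by positivity)
    rw [h3] at h7
    norm_num at h7
  have e2 : Real.exp (2 * (-Real.pi * (1 - 1 / 4) * (5 / 8))) ≤ 17 / 80 * (1 / 4) := by
    have h : Real.exp (2 * (-Real.pi * (1 - 1 / 4) * (5 / 8))) ≤ Real.exp (-(47 / 16)) := by
      rw [Real.exp_le_exp]; linarith
    refine h.trans ?_
    have h3 : Real.exp (-(47 / 16)) ^ 16 * Real.exp 1 ^ 47 = 1 := by
      rw [← Real.exp_nat_mul, ← Real.exp_nat_mul, ← Real.exp_add]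
      norm_num
    have h4 : (2.7182818283 : ℝ) ^ 47 ≤ Real.exp 1 ^ 47 := by gcongr
    by_contra! h5
    have h6 : (17 / 80 * (1 / 4) : ℝ) ^ 16 ≤ Real.exp (-(47 / 16)) ^ 16 := by gcongr
    have h7 := mul_le_mul h6 h4 (by norm_num) (by positivity)
    rw [h3] at h7
    norm_num at h7
  have b1 := exp_mul_inv_sqrt_pow_le hd (by norm_num) e1 (by norm_num)
  have b2 := exp_mul_inv_sqrt_pow_le hd (by norm_num) e2 (by norm_num)
  rw [mul_assoc (-Real.pi * (1 - 2 / 5)) (2 / 5 : ℝ) (d : ℝ)] at b1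
  rw [mul_assoc (-Real.pi * (1 - 1 / 4)) (5 / 8 : ℝ) (d : ℝ)] at b2
  have := mul_le_mul_of_nonneg_right b1 hp.le
  have := mul_le_mul_of_nonneg_right b2 hp.le
  nlinarith

theorem arithMin_pos (hd : 1 ≤ d) (hA : A.PosDef) : 0 < arithMin A := by
  obtain ⟨x, hx, h⟩ := (arithMin_isLeast hd hA).1
  rw [← h, quadValue_eq_realQuad]
  refine realQuad_pos hA fun h0 => hx (funext fun i => ?_)
  simpa [intVec] using congrFun h0 i

theorem exists_dual_vector_le (hd : 2 ≤ d) (hA : A.PosDef) {u : Fin d → ℝ} (hu : u ≠ 0) :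
    ∃ y : Fin d → ℤ, quadValue A⁻¹ y ≤ d ^ 2 / arithMin A ∧ intVec y ⬝ᵥ u ≠ 0 := by
  by_contra! hcon
  have hl := arithMin_pos (by omega) hA
  have hd0 : (0 : ℝ) < d := by exact_mod_cast (by omega : 0 < d)
  have hqu := realQuad_pos hA hu
  set l := arithMin A with hldef
  -- `α` scales the minimum to 8d/5, and `s` puts `s • u` at a quarter of it. Every translate then
  -- has value at least 4d/5 − 2d/5 = 2d/5, while d²/l becomes 5d/8 on the dual side.
  set α : ℝ := 8 / 5 * d / l with hα
  have hα0 : 0 < α := by positivity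
  have hinv : (α • A)⁻¹ = α⁻¹ • A⁻¹ := by
    have := Matrix.inv_smul' A (Units.mk0 α hα0.ne') hA.det_pos.ne'.isUnit
    simpa [Units.smul_def] using this
  set s : ℝ := √(l / (4 * realQuad A u)) with hs
  have hsu : realQuad (α • A) (s • u) = 2 / 5 * d := by
    rw [realQuad_smul_matrix, realQuad_smul, hs, Real.sq_sqrt (by positivity), hα]
    field_simp
    norm_num
  refine not_forall_le_of_orthogonal hd (hA.smul hα0) (s • u) (fun x => ?_) fun k hk => ?_
  · by_cases hx : x = 0
    · have : intVec x = 0 := by funext i; simp [hx, intVec]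
      rw [this, zero_add, hsu]
    · have h := realQuad_le_two_mul (hA.smul hα0) (s • u) (intVec x)
      have hx' : l ≤ realQuad A (intVec x) := (arithMin_isLeast (by omega) hA).2 ⟨x, hx, rfl⟩
      have h3 : 8 / 5 * d ≤ realQuad (α • A) (intVec x) := by
        rw [realQuad_smul_matrix]
        calc (8 / 5 * d : ℝ) = α * l := by rw [hα]; field_simp
          _ ≤ _ := by gcongr
      linarith
  · have hk' : intVec k ⬝ᵥ u ≠ 0 := fun h0 => hk (by simp [dotProduct_smul, h0])
    have h : (d : ℝ) ^ 2 / l < quadValue A⁻¹ k := by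
      by_contra! h
      exact hk' (hcon k h)
    rw [hinv, realQuad_smul_matrix, ← quadValue_eq_realQuad]
    calc (5 / 8 * d : ℝ) = α⁻¹ * (d ^ 2 / l) := by rw [hα]; field_simp
      _ ≤ _ := by gcongr

end Transference

/-! ### From short independent vectors to a short lattice basis -/

section ShortBasis

variable {V : Type*} [NormedAddCommGroup V] [InnerProductSpace ℝ V]

theorem range_eq_insert_last {α : Type*} {k : ℕ} (v : Fin (k + 1) → α) :
    Set.range v = insert (v (Fin.last k)) (Set.range (Fin.init v)) := by
  conv_lhs => rw [← Fin.snoc_init_self v, Fin.range_snoc]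

theorem norm_add_sq_of_mem_orthogonal {W : Submodule ℝ V} {w e : V} (hw : w ∈ W) (he : e ∈ Wᗮ) :
    ‖w + e‖ ^ 2 = ‖w‖ ^ 2 + ‖e‖ ^ 2 := by
  have := norm_add_sq_eq_norm_sq_add_norm_sq_of_inner_eq_zero w e
    (Submodule.inner_right_of_mem_orthogonal hw he)
  simpa [sq] using this

/-- Nearest-plane rounding: each rounded coefficient leaves an orthogonal error of squared length at
most R/4; the component in the smaller span passes to the recursion. -/
theorem exists_mem_span_int_norm_sub_sq_le {R : ℝ} {k : ℕ} (v : Fin k → V)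
    (hv : ∀ i, ‖v i‖ ^ 2 ≤ R) (x : V) (hx : x ∈ Submodule.span ℝ (Set.range v)) :
    ∃ z ∈ Submodule.span ℤ (Set.range v), ‖x - z‖ ^ 2 ≤ k / 4 * R := by
  induction k generalizing x with
  | zero =>
    have : x = 0 := by simpa using hx
    exact ⟨0, zero_mem _, by simp [this]⟩
  | succ k ih =>
    rw [range_eq_insert_last, Submodule.mem_span_insert] at hx
    obtain ⟨c, w, hw, rfl⟩ := hx
    set W := Submodule.span ℝ (Set.range (Fin.init v)) with hW
    have : FiniteDimensional ℝ W := FiniteDimensional.span_of_finite ℝ (Set.finite_range _)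
    obtain ⟨p, hp, q, hq, hpq⟩ := W.exists_add_mem_mem_orthogonal ((c - round c) • v (Fin.last k))
    obtain ⟨z, hz, hzle⟩ := ih (Fin.init v) (fun i => hv _) (w + p) (add_mem hw hp)
    have hzW : z ∈ W := Submodule.span_le_restrictScalars ℤ ℝ _ hz
    refine ⟨round c • v (Fin.last k) + z, ?_, ?_⟩
    · rw [range_eq_insert_last]
      exact add_mem (Submodule.smul_mem _ _ (Submodule.subset_span (Set.mem_insert _ _)))
        (Submodule.span_mono (Set.subset_insert _ _) hz)
    · have h1 : c • v (Fin.last k) + w - (round c • v (Fin.last k) + z) = (w + p - z) + q := by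
        have h2 : round c • v (Fin.last k) = (round c : ℝ) • v (Fin.last k) :=
          (Int.cast_smul_eq_zsmul ℝ _ _).symm
        rw [sub_smul] at hpq
        rw [h2, eq_add_of_sub_eq hpq]
        abel
      rw [h1, norm_add_sq_of_mem_orthogonal (sub_mem (add_mem hw hp) hzW) hq]
      have h3 : ‖q‖ ^ 2 ≤ ‖(c - round c) • v (Fin.last k)‖ ^ 2 := by
        rw [hpq, norm_add_sq_of_mem_orthogonal hp hq]
        exact le_add_of_nonneg_left (sq_nonneg _)
      have h4 : ‖(c - round c) • v (Fin.last k)‖ ^ 2 ≤ 1 / 4 * R := by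
        rw [norm_smul, mul_pow, Real.norm_eq_abs]
        have h5 := abs_sub_round c
        have h6 : |c - round c| ^ 2 ≤ 1 / 4 := by nlinarith [abs_nonneg (c - round c)]
        exact mul_le_mul h6 (hv _) (sq_nonneg _) (by norm_num)
      push_cast
      linarith

theorem exists_short_int_basis {R : ℝ} {k : ℕ} (v : Fin k → V) (hv : LinearIndependent ℝ v)
    (hR : ∀ i, ‖v i‖ ^ 2 ≤ R) (L : Submodule ℤ V) (hL : ∀ i, v i ∈ L)
    (hLs : ∀ x ∈ L, x ∈ Submodule.span ℝ (Set.range v))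
    (hfin : ∀ r : ℝ, {x | x ∈ L ∧ ‖x‖ ^ 2 ≤ r}.Finite) :
    ∃ b : Fin k → V, Submodule.span ℤ (Set.range b) = L ∧
      ∀ i : Fin k, ‖b i‖ ^ 2 ≤ max 1 (((i : ℕ) + 1 : ℝ) / 4) * R := by
  induction k generalizing L with
  | zero =>
    refine ⟨v, le_antisymm ?_ fun x hx => ?_, fun i => i.elim0⟩
    · rw [Submodule.span_le]
      rintro _ ⟨i, rfl⟩
      exact hL i
    · have : x = 0 := by simpa using hLs x hx
      simp [this]
  | succ k ih =>
    obtain ⟨hv', hlast⟩ := linearIndependent_finSucc'.mp hv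
    set W := Submodule.span ℝ (Set.range (Fin.init v)) with hW
    have : FiniteDimensional ℝ W := FiniteDimensional.span_of_finite ℝ (Set.finite_range _)
    set a := v (Fin.last k) with ha
    obtain ⟨w₀, hw₀, e, he, hae⟩ := W.exists_add_mem_mem_orthogonal a
    have he0 : e ≠ 0 := by
      rintro rfl
      exact hlast (by rw [hae, add_zero]; exact hw₀)
    have hen : 0 < ‖e‖ ^ 2 := by positivity
    have heR : ‖e‖ ^ 2 ≤ R := by
      refine le_trans ?_ (hR (Fin.last k))
      rw [← ha, hae, norm_add_sq_of_mem_orthogonal hw₀ he]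
      exact le_add_of_nonneg_left (sq_nonneg _)
    have hR0 : 0 ≤ R := hen.le.trans heR
    -- Height above the hyperplane `W`, normalised so that `a` has height 1.
    let c : V →ₗ[ℝ] ℝ := (‖e‖ ^ 2)⁻¹ • (innerₛₗ ℝ e)
    have hc : ∀ x, c x = (‖e‖ ^ 2)⁻¹ * inner ℝ e x := fun x => by simp [c]
    have hcW : ∀ w ∈ W, c w = 0 := fun w hw => by
      rw [hc, Submodule.inner_left_of_mem_orthogonal hw he, mul_zero]
    have hce : c e = 1 := by
      rw [hc, real_inner_self_eq_norm_sq, inv_mul_cancel₀ hen.ne']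
    have hca : c a = 1 := by rw [hae, map_add, hcW _ hw₀, hce, zero_add]
    have hcsub : ∀ x ∈ L, x - c x • e ∈ W := by
      intro x hx
      have hx' := hLs x hx
      rw [range_eq_insert_last, Submodule.mem_span_insert] at hx'
      obtain ⟨t, w, hw, rfl⟩ := hx'
      have : t • a + w - c (t • a + w) • e = t • w₀ + w := by
        rw [map_add, map_smul, hca, hcW w hw, hae, smul_add]
        simp only [smul_eq_mul, mul_one, add_zero]
        abel
      rw [← ha, this]
      exact add_mem (W.smul_mem _ hw₀) hw
    have hspanL : Submodule.span ℤ (Set.range (Fin.init v)) ≤ L := by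
      rw [Submodule.span_le]
      rintro _ ⟨i, rfl⟩
      exact hL _
    -- Rounding inside `W` shortens a vector without changing its height.
    have hred : ∀ x ∈ L, ∃ y ∈ L, c y = c x ∧ ‖y‖ ^ 2 ≤ k / 4 * R + c x ^ 2 * R := by
      intro x hx
      obtain ⟨z, hz, hzle⟩ := exists_mem_span_int_norm_sub_sq_le (Fin.init v) (fun i => hR _)
        _ (hcsub x hx)
      have hzW : z ∈ W := Submodule.span_le_restrictScalars ℤ ℝ _ hz
      refine ⟨x - z, sub_mem hx (hspanL hz), by rw [map_sub, hcW z hzW, sub_zero], ?_⟩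
      have h1 : x - z = (x - c x • e - z) + c x • e := by abel
      rw [h1, norm_add_sq_of_mem_orthogonal (sub_mem (hcsub x hx) hzW) (Wᗮ.smul_mem _ he),
        norm_smul, mul_pow, Real.norm_eq_abs, sq_abs]
      gcongr
    obtain ⟨a', ha'L, hca', ha'n⟩ := hred a (hL _)
    rw [hca] at hca' ha'n
    -- By `hred`, every height of modulus at most 1 occurs in this finite ball, so its least nonzero
    -- height generates all heights of `L`.
    have hSfin : {y | (y ∈ L ∧ ‖y‖ ^ 2 ≤ k / 4 * R + R) ∧ c y ≠ 0}.Finite :=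
      (hfin _).subset fun y hy => hy.1
    have ha'S : a' ∈ {y | (y ∈ L ∧ ‖y‖ ^ 2 ≤ k / 4 * R + R) ∧ c y ≠ 0} :=
      ⟨⟨ha'L, by linarith⟩, by simp [hca']⟩
    obtain ⟨x₀, ⟨⟨hx₀L, hx₀n⟩, hx₀c⟩, hmin⟩ :=
      Set.exists_min_image _ (fun y => |c y|) hSfin ⟨a', ha'S⟩
    have hx₀1 : |c x₀| ≤ 1 := by simpa [hca'] using hmin a' ha'S
    have hmul : ∀ x ∈ L, ∃ m : ℤ, c x = m * c x₀ := by
      intro x hx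
      refine ⟨round (c x / c x₀), ?_⟩
      set m := round (c x / c x₀) with hm
      have hyL : x - m • x₀ ∈ L := sub_mem hx (L.smul_mem _ hx₀L)
      have hcy : c (x - m • x₀) = c x - m * c x₀ := by
        rw [map_sub, map_zsmul, zsmul_eq_mul]
      have habs : |c x - m * c x₀| < |c x₀| := by
        have h1 : c x - m * c x₀ = (c x / c x₀ - m) * c x₀ := by field_simp
        have h2 := abs_sub_round (c x / c x₀)
        have h3 := abs_pos.mpr hx₀c
        rw [h1, abs_mul]
        nlinarith
      by_contra hne
      obtain ⟨y, hyL', hy, hyn⟩ := hred _ hyL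
      rw [hcy] at hy hyn
      have hsq : (c x - m * c x₀) ^ 2 ≤ 1 := by
        rw [← sq_abs]
        nlinarith [abs_nonneg (c x - m * c x₀)]
      have := hmin y ⟨⟨hyL', by nlinarith⟩, by rw [hy]; exact sub_ne_zero.mpr hne⟩
      simp only [hy] at this
      linarith
    -- If `a` already generates the heights, it is kept, at cost R. Otherwise the generator has
    -- height at most 1/2, and its reduction costs at most (k/4 + 1/4) R.
    obtain ⟨bl, hblL, hbln, hblm⟩ : ∃ bl ∈ L,
        ‖bl‖ ^ 2 ≤ max 1 ((k + 1 : ℝ) / 4) * R ∧ ∀ x ∈ L, ∃ m : ℤ, c x = m * c bl := by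
      obtain ⟨m, hm⟩ := hmul a (hL _)
      rw [hca] at hm
      by_cases hm1 : |m| ≤ 1
      · refine ⟨a, hL _, ?_, fun x hx => ?_⟩
        · exact (hR _).trans (le_mul_of_one_le_left hR0 (le_max_left _ _))
        · obtain ⟨n, hn⟩ := hmul x hx
          have hm2 : m = 1 ∨ m = -1 := by
            have : m ≠ 0 := by rintro rfl; simp at hm
            rw [abs_le] at hm1
            omega
          rcases hm2 with rfl | rfl
          · exact ⟨n, by rw [hn, hca, hm]; simp⟩
          · refine ⟨-n, ?_⟩
            push_cast at hm ⊢
            rw [hn, hca]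
            linear_combination (n : ℝ) * hm
      · obtain ⟨y, hyL, hy, hyn⟩ := hred x₀ hx₀L
        refine ⟨y, hyL, ?_, by rwa [hy]⟩
        have hm2 : (2 : ℝ) ≤ |(m : ℝ)| := by
          have : 2 ≤ |m| := by omega
          exact_mod_cast this
        have h1 : |(m : ℝ)| * |c x₀| = 1 := by rw [← abs_mul, ← hm, abs_one]
        have h2 : |c x₀| ≤ 1 / 2 := by nlinarith [abs_nonneg (c x₀)]
        have h3 : c x₀ ^ 2 ≤ 1 / 4 := by
          rw [← sq_abs]
          nlinarith [abs_nonneg (c x₀)]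
        calc ‖y‖ ^ 2 ≤ k / 4 * R + c x₀ ^ 2 * R := hyn
          _ ≤ k / 4 * R + 1 / 4 * R := by gcongr
          _ = (k + 1 : ℝ) / 4 * R := by ring
          _ ≤ _ := by gcongr; exact le_max_right _ _
    obtain ⟨b', hb', hb'n⟩ := ih (Fin.init v) hv' (fun i => hR _)
      (L ⊓ W.restrictScalars ℤ) (fun i => ⟨hL _, Submodule.subset_span ⟨i, rfl⟩⟩)
      (fun x hx => hx.2) (fun r => (hfin r).subset fun x hx => ⟨hx.1.1, hx.2⟩)
    refine ⟨Fin.snoc b' bl, ?_, fun i => ?_⟩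
    · rw [Fin.range_snoc, Submodule.span_insert, hb']
      refine le_antisymm (sup_le ?_ inf_le_left) fun x hx => ?_
      · rwa [Submodule.span_singleton_le_iff_mem]
      · obtain ⟨m, hm⟩ := hblm x hx
        have h1 : x - m • bl ∈ L := sub_mem hx (L.smul_mem _ hblL)
        have h2 : x - m • bl ∈ W := by
          have := hcsub _ h1
          rwa [map_sub, map_zsmul, zsmul_eq_mul, hm, sub_self, zero_smul, sub_zero] at this
        rw [← add_sub_cancel (m • bl) x]
        exact add_mem (Submodule.mem_sup_left (Submodule.smul_mem _ _
          (Submodule.mem_span_singleton_self _))) (Submodule.mem_sup_right ⟨h1, h2⟩)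
    · induction i using Fin.lastCases with
      | last => simpa using hbln
      | cast i => simpa using hb'n i

end ShortBasis

/-! ### Dual basis, coordinate bounds and conclusion -/

section Main

variable {d : ℕ} {A : Matrix (Fin d) (Fin d) ℝ}

theorem sq_dotProduct_le_realQuad_mul (hA : A.PosDef) (w z : Fin d → ℝ) :
    (w ⬝ᵥ z) ^ 2 ≤ realQuad A⁻¹ w * realQuad A z := by
  obtain ⟨S, hS, rfl⟩ := hA.exists_isUnit_eq_transpose_mul
  have hSd : IsUnit S.det := (Matrix.isUnit_iff_isUnit_det S).mp hS
  have hwz : w ⬝ᵥ z = ((S⁻¹)ᵀ *ᵥ w) ⬝ᵥ (S *ᵥ z) := by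
    rw [Matrix.mulVec_transpose, ← Matrix.dotProduct_mulVec, Matrix.mulVec_mulVec,
      Matrix.nonsing_inv_mul _ hSd, Matrix.one_mulVec]
  have hq : realQuad (Sᵀ * S)⁻¹ w = ∑ i, ((S⁻¹)ᵀ *ᵥ w) i ^ 2 := by
    rw [← realQuad_transpose_mul, Matrix.mul_inv_rev, Matrix.transpose_transpose,
      Matrix.transpose_nonsing_inv]
  rw [hwz, hq, realQuad_transpose_mul]
  exact Finset.sum_mul_sq_le_sq_mul_sq _ _ _

/-- A proper span would lie in the kernel of a nonzero functional, which is pairing with a vector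
`u` excluded by `exists_dual_vector_le`. -/
theorem span_dual_vectors_eq_top (hd : 2 ≤ d) (hA : A.PosDef) :
    Submodule.span ℝ (intVec '' {y : Fin d → ℤ | quadValue A⁻¹ y ≤ d ^ 2 / arithMin A}) = ⊤ := by
  by_contra hne
  obtain ⟨f, hf0, hf⟩ := Submodule.exists_le_ker_of_lt_top _ (lt_top_iff_ne_top.mpr hne)
  have hfu : ∀ x, f x = x ⬝ᵥ fun i => f (Pi.single i 1) := by
    intro x
    conv_lhs => rw [pi_eq_sum_univ' x]
    simp [dotProduct]
  have hu : (fun i => f (Pi.single i 1)) ≠ 0 := by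
    intro h
    refine hf0 (LinearMap.ext fun x => ?_)
    rw [hfu, h, dotProduct_zero, LinearMap.zero_apply]
  obtain ⟨y, hy, hyu⟩ := exists_dual_vector_le hd hA hu
  rw [← hfu] at hyu
  exact hyu (hf (Submodule.subset_span ⟨y, hy, rfl⟩))

theorem exists_linearIndependent_fin_of_span_eq_top {s : Set (Fin d → ℝ)}
    (hs : Submodule.span ℝ s = ⊤) :
    ∃ v : Fin d → Fin d → ℝ, LinearIndependent ℝ v ∧ ∀ i, v i ∈ s := by
  obtain ⟨t, hts, htspan, hli⟩ := exists_linearIndependent ℝ s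
  let B : Module.Basis t ℝ (Fin d → ℝ) := Module.Basis.mk hli (by simp [htspan, hs])
  let e := B.indexEquiv (Pi.basisFun ℝ (Fin d))
  exact ⟨fun i => (e.symm i : Fin d → ℝ), hli.comp _ e.symm.injective, fun i => hts (e.symm i).2⟩

/-- A root `S` of A embeds ℤᵈ in Euclidean space as a lattice. The short basis, pulled back, gives
the rows of `W`; `T` expresses the standard basis in them. -/
theorem exists_short_unimodular (hA : A.PosDef) {R : ℝ}
    (hspan : Submodule.span ℝ (intVec '' {y : Fin d → ℤ | quadValue A y ≤ R}) = ⊤) :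
    ∃ T W : Matrix (Fin d) (Fin d) ℤ, T * W = 1 ∧
      ∀ i : Fin d, quadValue A (W i) ≤ max 1 (((i : ℕ) + 1 : ℝ) / 4) * R := by
  obtain ⟨v, hv, hvs⟩ := exists_linearIndependent_fin_of_span_eq_top hspan
  choose y hy hyv using hvs
  obtain ⟨S, hS, hSA⟩ := hA.exists_isUnit_eq_transpose_mul
  let ψ : (Fin d → ℝ) →ₗ[ℝ] EuclideanSpace ℝ (Fin d) :=
    (WithLp.linearEquiv 2 ℝ (Fin d → ℝ)).symm.toLinearMap ∘ₗ Matrix.toLin' S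
  have hψn : ∀ x, ‖ψ x‖ ^ 2 = realQuad A x := by
    intro x
    rw [EuclideanSpace.norm_sq_eq, hSA, realQuad_transpose_mul]
    simp [ψ]
  have hψinj : Function.Injective ψ := by
    refine (injective_iff_map_eq_zero ψ).mpr fun x hx => ?_
    by_contra hne
    have := realQuad_pos hA hne
    rw [← hψn, hx] at this
    simp at this
  let φ : (Fin d → ℤ) →ₗ[ℤ] EuclideanSpace ℝ (Fin d) := AddMonoidHom.toIntLinearMap
    { toFun := fun x => ψ (intVec x)
      map_zero' := by
        have : intVec (0 : Fin d → ℤ) = 0 := by funext i; simp [intVec]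
        rw [this, map_zero]
      map_add' := fun x z => by
        rw [← map_add]
        congr 1
        funext i
        simp [intVec] }
  have hφ : ∀ x, φ x = ψ (intVec x) := fun x => rfl
  have hφn : ∀ x, ‖φ x‖ ^ 2 = quadValue A x := fun x => hψn _
  have hφinj : Function.Injective φ := by
    intro x z h
    have := hψinj h
    funext i
    simpa [intVec] using congrFun this i
  have hli : LinearIndependent ℝ fun i => ψ (v i) :=
    hv.map' ψ (LinearMap.ker_eq_bot.mpr hψinj)
  obtain ⟨b, hb, hbn⟩ := exists_short_int_basis (R := R) (fun i => ψ (v i)) hli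
    (fun i => by rw [← hyv i, hψn]; exact hy i) (LinearMap.range φ)
    (fun i => ⟨y i, by rw [hφ, hyv]⟩)
    (fun x _ => by
      rw [hli.span_eq_top_of_card_eq_finrank' (by simp)]
      trivial)
    (fun r => ((quadValue_finite hA r).image φ).subset (by
      rintro _ ⟨⟨x, rfl⟩, hx⟩
      exact ⟨x, by rwa [hφn] at hx, rfl⟩))
  have hbr : ∀ i, ∃ w, φ w = b i := fun i => by
    have : b i ∈ LinearMap.range φ := hb ▸ Submodule.subset_span ⟨i, rfl⟩
    exact this
  choose w hw using hbr
  have hwspan : ∀ x, x ∈ Submodule.span ℤ (Set.range w) := by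
    intro x
    have h1 : φ x ∈ Submodule.map φ (Submodule.span ℤ (Set.range w)) := by
      rw [Submodule.map_span, ← Set.range_comp, show φ ∘ w = b from funext hw, hb]
      exact ⟨x, rfl⟩
    obtain ⟨z, hz, hzx⟩ := h1
    rwa [hφinj hzx] at hz
  choose T hT using fun j =>
    (Submodule.mem_span_range_iff_exists_fun ℤ).mp (hwspan (Pi.single j 1))
  refine ⟨Matrix.of T, Matrix.of w, ?_, fun i => ?_⟩
  · ext j k
    have := congrFun (hT j) k
    simp only [Finset.sum_apply, Pi.smul_apply, smul_eq_mul] at this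
    simp [Matrix.mul_apply, this, Matrix.one_apply, Pi.single_apply, eq_comm]
  · rw [← hφn]
    exact (congrArg (‖·‖ ^ 2) (hw i)).trans_le (hbn i)

theorem quadValue_transpose_mul_mul (Q : Matrix (Fin d) (Fin d) ℝ)
    (T : Matrix (Fin d) (Fin d) ℤ) (x : Fin d → ℤ) :
    quadValue ((T.map (Int.cast : ℤ → ℝ))ᵀ * Q * T.map (Int.cast : ℤ → ℝ)) x =
      quadValue Q (T *ᵥ x) := by
  have h : (fun i => ((T *ᵥ x) i : ℝ)) = T.map (Int.cast : ℤ → ℝ) *ᵥ fun i => (x i : ℝ) := by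
    funext i
    simp [Matrix.mulVec, dotProduct]
  unfold quadValue
  rw [h, ← Matrix.mulVec_mulVec, ← Matrix.mulVec_mulVec, Matrix.dotProduct_mulVec,
    Matrix.vecMul_transpose]

theorem arithMin_transpose_mul_mul (Q : Matrix (Fin d) (Fin d) ℝ)
    {T W : Matrix (Fin d) (Fin d) ℤ} (hTW : T * W = 1) :
    arithMin ((T.map (Int.cast : ℤ → ℝ))ᵀ * Q * T.map (Int.cast : ℤ → ℝ)) = arithMin Q := by
  have hWT : W * T = 1 := mul_eq_one_comm.mp hTW
  unfold arithMin
  congr 1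
  ext r
  simp only [quadValue_transpose_mul_mul, Set.mem_ofPred_eq]
  constructor
  · rintro ⟨x, hx, h⟩
    refine ⟨T *ᵥ x, fun h0 => hx ?_, h⟩
    rw [← Matrix.one_mulVec x, ← hWT, ← Matrix.mulVec_mulVec, h0, Matrix.mulVec_zero]
  · rintro ⟨z, hz, h⟩
    have hz' : T *ᵥ (W *ᵥ z) = z := by rw [Matrix.mulVec_mulVec, hTW, Matrix.one_mulVec]
    refine ⟨W *ᵥ z, fun h0 => hz ?_, by rw [hz', h]⟩
    rw [← hz', h0, Matrix.mulVec_zero]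

theorem sum_max_one_le (d : ℕ) :
    ∑ i : Fin d, max 1 (((i : ℕ) + 1 : ℝ) / 4) ≤ (d : ℝ) * (d + 7) / 8 := by
  induction d with
  | zero => simp
  | succ d ih =>
    rw [Fin.sum_univ_castSucc]
    simp only [Fin.val_castSucc, Fin.val_last]
    -- This majorant of the maximum sums exactly to d(d+7)/8.
    have h : max 1 ((d + 1 : ℝ) / 4) ≤ (d + 4 : ℝ) / 4 :=
      max_le (by linarith [(Nat.cast_nonneg d : (0 : ℝ) ≤ d)]) (by linarith)
    push_cast
    linarith

theorem sq_le_one_of_mem_minVectors {Q : Matrix (Fin 1) (Fin 1) ℝ} (hQ : Q.PosDef)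
    {x : Fin 1 → ℤ} (hx : x ∈ minVectors Q) : x 0 ^ 2 ≤ 1 := by
  have hq : ∀ z : Fin 1 → ℤ, quadValue Q z = Q 0 0 * (z 0 : ℝ) ^ 2 := by
    intro z
    simp [quadValue, Matrix.mulVec, dotProduct]
    ring
  have h1 : arithMin Q ≤ quadValue Q fun _ => 1 :=
    (arithMin_isLeast le_rfl hQ).2 ⟨_, fun h => by simpa using congrFun h 0, rfl⟩
  have hx' : quadValue Q x = arithMin Q := hx
  rw [← hx', hq, hq] at h1
  have hpos : 0 < Q 0 0 := hQ.diag_pos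
  have h2 : ((x 0 : ℝ)) ^ 2 ≤ 1 := by
    have := le_of_mul_le_mul_left h1 hpos
    simpa using this
  exact_mod_cast h2

end Main

theorem mainTheorem3 (d : ℕ) (hd : 1 ≤ d) (Q : Matrix (Fin d) (Fin d) ℝ) (hQ : Q.PosDef) :
    ∃ Q' : Matrix (Fin d) (Fin d) ℝ, Q'.PosDef ∧ ArithEquiv Q Q' ∧
      ∀ x ∈ minVectors Q', ((x ⬝ᵥ x : ℤ) : ℝ) ≤ (d : ℝ) ^ 3 * ((d : ℝ) + 7) / 8 := by
  -- The numerical estimates need d ≥ 2; for d = 1 the bound is 1 and `Q` itself serves.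
  rcases hd.eq_or_lt with rfl | hd2
  · refine ⟨Q, hQ, ⟨1, by simp⟩, fun x hx => ?_⟩
    have h : x ⬝ᵥ x ≤ 1 := by
      simpa [dotProduct, sq] using sq_le_one_of_mem_minVectors hQ hx
    have h' : ((x ⬝ᵥ x : ℤ) : ℝ) ≤ 1 := by exact_mod_cast h
    norm_num
    exact h'
  obtain ⟨T, W, hTW, hW⟩ := exists_short_unimodular hQ.inv (span_dual_vectors_eq_top hd2 hQ)
  have hWT : W * T = 1 := mul_eq_one_comm.mp hTW
  have hl := arithMin_pos hd hQ
  refine ⟨(T.map (Int.cast : ℤ → ℝ))ᵀ * Q * T.map (Int.cast : ℤ → ℝ), ?_,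
    ⟨⟨T, W, hTW, hWT⟩, rfl⟩, fun x hx => ?_⟩
  · have hinj : Function.Injective (T.map (Int.cast : ℤ → ℝ)).mulVec := by
      refine Matrix.mulVec_injective_of_isUnit (IsUnit.of_mul_eq_one_right
        (W.map (Int.cast : ℤ → ℝ)) ?_)
      have h : (Int.castRingHom ℝ).mapMatrix W * (Int.castRingHom ℝ).mapMatrix T = 1 := by
        rw [← map_mul, hWT, map_one]
      exact h
    simpa using hQ.conjTranspose_mul_mul_same hinj
  · have hx' : quadValue Q (T *ᵥ x) = arithMin Q := by
      rw [← quadValue_transpose_mul_mul, ← arithMin_transpose_mul_mul Q hTW]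
      exact hx
    have hxi : ∀ i, ((x i : ℤ) : ℝ) ^ 2 ≤ max 1 (((i : ℕ) + 1 : ℝ) / 4) * d ^ 2 := by
      intro i
      have h1 : x i = W i ⬝ᵥ (T *ᵥ x) := by
        conv_lhs => rw [← Matrix.one_mulVec x, ← hWT, ← Matrix.mulVec_mulVec]
        rfl
      have h2 : (x i : ℝ) = intVec (W i) ⬝ᵥ intVec (T *ᵥ x) := by
        rw [h1]
        simp [dotProduct, intVec]
      have h3 := sq_dotProduct_le_realQuad_mul hQ (intVec (W i)) (intVec (T *ᵥ x))
      rw [← h2, ← quadValue_eq_realQuad, ← quadValue_eq_realQuad, hx'] at h3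
      refine h3.trans ((mul_le_mul_of_nonneg_right (hW i) hl.le).trans_eq ?_)
      rw [mul_assoc, div_mul_cancel₀ _ hl.ne']
    calc ((x ⬝ᵥ x : ℤ) : ℝ) = ∑ i, (x i : ℝ) ^ 2 := by simp [dotProduct, sq]
      _ ≤ ∑ i : Fin d, max 1 (((i : ℕ) + 1 : ℝ) / 4) * d ^ 2 := Finset.sum_le_sum fun i _ => hxi i
      _ = (∑ i : Fin d, max 1 (((i : ℕ) + 1 : ℝ) / 4)) * d ^ 2 := by rw [Finset.sum_mul]
      _ ≤ ((d : ℝ) * (d + 7) / 8) * d ^ 2 := by gcongr; exact sum_max_one_le d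
      _ = _ := by ring
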